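/- **Theorem 2.1.** A topological space is a *P-space* if the intersection of any countable family of its open sets is open, and it is *locally Lindelöf* if every point has a Lindelöf neighbourhood. For a space $X$ let $X^{\alpha}$ be its $\alpha$-th Cantor–Bendixson derivative. $X$ is *scattered* if $X^{\alpha}=\emptyset$ for some ordinal $\alpha$. In that case its height $\mathrm{ht}(X)$ is the least such $\alpha$, its levels are $I_\alpha(X)=X^{\alpha}\setminus X^{\alpha+1}$, and its width is $\sup\{|I_\alpha(X)|:\alpha<\mathrm{ht}(X)\}$. A neighbourhood $U$ of $x$ is a *cone on $x$* if $x$ is the only point of $U$ whose level is at least the level of $x$. An *LLSP space* is a locally Lindelöf, scattered, Hausdorff P-space; it is an $(\omega_1,\omega_2)$-LLSP space if it has width $\omega_1$ and height $\omega_2$. An LLSP space $X$ is *good* if for every $\alpha<\mathrm{ht}(X)$ and all Lindelöf clopen cones $U_n$ ($n\in\omega$) on points of $X$, the set $I_\alpha(X)\setminus\bigcup_n U_n$ is uncountable. For $x\in I_{\beta+1}(X)$, a neighbourhood basis $\mathbb B_x$ of $x$ is the *admissible basis given by* a pairwise disjoint family $\{U_\nu:\nu<\omega_1\}$ if each $U_\nu$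 is a Lindelöf clopen cone on some point of $I_\beta(X)$ and $\mathbb B_x$ consists exactly of the sets $\{x\}\cup\bigcup\{U_\nu:\nu\ge\xi\}$, $\xi<\omega_1$. $X$ is *admissible* if one can choose neighbourhood bases $\mathbb B_x$ ($x\in X$) such that, whenever $\beta+1<\mathrm{ht}(X)$, every $\mathbb B_x$ with $x\in I_{\beta+1}(X)$ is admissible, and whenever $x\ne y$ are in $I_{\beta+1}(X)$ and $\mathbb B_x$, $\mathbb B_y$ are given by $\{U_\nu\}$, $\{U'_\nu\}$, respectively, we have $U_\nu\cap U'_\mu=\emptyset$ for all $\nu,\mu<\omega_1$. There is a topology on the set $\omega_2$ for which the resulting space $X$ is an $(\omega_1,\omega_2)$-LLSP space that is good and admissible. Moreover, the topology can be chosen so that in addition: 1. $I_\alpha(X)=(\omega_1\cdot(\alpha+1))\setminus(\omega_1\cdot\alpha)$ for every $\alpha<\omega_2$; 2. for every $\xi<\omega_1$ the column $N_\xi=\{\omega_1\cdot\mu+\xi:\mu<\omega_2\}$ is a closed discrete subset of $X$; 3. for every $\alpha$ with $0<\alpha<\omega_2$ (in particular for every limit $\alpha$ of cofinality $\omega$)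 the union $\omega_1\cdot\alpha=\bigcup_{\beta<\alpha}I_\beta(X)$ of the levels below $\alpha$ is not Lindelöf. -/

import Mathlib

open Set Filter Topology
open scoped Ordinal Cardinal CantorBendixson

universe u

namespace LLSP

section Space

variable (X : Type u) [TopologicalSpace X]

/-- A P-space: the intersection of every countable family of open sets is open. -/
def IsPSpace : Prop :=
  ∀ S : Set (Set X), S.Countable → (∀ U ∈ S, IsOpen U) → IsOpen (⋂₀ S)

/-- Locally Lindelöf: every point has a Lindelöf neighbourhood. (In a Hausdorff P-space the
Lindelöf neighbourhoods of a point then form a neighbourhood basis.) -/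
def IsLocallyLindelof : Prop :=
  ∀ x : X, ∃ U ∈ 𝓝 x, IsLindelof U

/-- The `α`-th Cantor–Bendixson derivative of the whole space. -/
def cbDeriv (α : Ordinal.{u}) : Set X := (univ : Set X)ᵈ[α]

/-- Scattered: some Cantor–Bendixson derivative is empty. -/
def IsScattered : Prop := ∃ α : Ordinal.{u}, cbDeriv X α = ∅

/-- The height of a scattered space: the least `α` whose derivative is empty. -/
noncomputable def cbHeight : Ordinal.{u} := sInf {α | cbDeriv X α = ∅}

/-- The `α`-th Cantor–Bendixson level. -/
def cbLevel (α : Ordinal.{u}) : Set X := cbDeriv X α \ cbDeriv X (α + 1)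

/-- The width of a scattered space: the supremum of the cardinalities of the levels below the
height (a family of cardinals bounded by the cardinality of the space). -/
noncomputable def cbWidth : Cardinal.{u} :=
  ⨆ α : Set.Iio (cbHeight X), #(cbLevel X α.1)

/-- A locally Lindelöf, scattered, Hausdorff P-space. -/
structure IsLLSP : Prop where
  locallyLindelof : IsLocallyLindelof X
  scattered : IsScattered X
  t2 : T2Space X
  pSpace : IsPSpace X

/-- An LLSP space of width `κ` (an uncountable cardinal) and height `α` (a nonzero ordinal). -/
structure IsLLSPOf (κ : Cardinal.{u}) (α : Ordinal.{u}) : Prop where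
  uncountable : ℵ₀ < κ
  ne_zero : α ≠ 0
  isLLSP : IsLLSP X
  height_eq : cbHeight X = α
  width_eq : cbWidth X = κ

variable {X}

/-- `U` is a cone on `x`: a neighbourhood of `x` in which `x` is the only point whose level is
at least the level of `x`. -/
def IsCone (U : Set X) (x : X) : Prop :=
  U ∈ 𝓝 x ∧ ∃ α, x ∈ cbLevel X α ∧ ∀ y ∈ U, ∀ β, α ≤ β → y ∈ cbLevel X β → y = x

/-- `U` is a Lindelöf clopen cone on `x`. -/
structure IsLCCone (U : Set X) (x : X) : Prop where
  lindelof : IsLindelof U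
  clopen : IsClopen U
  cone : IsCone U x

/-- `𝓑` is the admissible basis for the point `x`, of level `β + 1`, given by the family
`U ν` (`ν < ω₁`). -/
structure IsAdmissibleBasis (β : Ordinal.{u}) (x : X) (𝓑 : Set (Set X))
    (U : Set.Iio (ω_ 1 : Ordinal.{u}) → Set X) : Prop where
  mem_level : x ∈ cbLevel X (β + 1)
  hasBasis : (𝓝 x).HasBasis (fun V => V ∈ 𝓑) (fun V => V)
  disjoint : ∀ ν μ, ν ≠ μ → Disjoint (U ν) (U μ)
  isCone : ∀ ν, ∃ y ∈ cbLevel X β, IsLCCone (U ν) y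
  eq_range : 𝓑 = Set.range fun ξ => {x} ∪ ⋃ ν, ⋃ (_ : ξ ≤ ν), U ν

variable (X)

/-- An admissible space: there is a choice of neighbourhood bases which, at the points of
each successor level, are admissible, and such that the families giving the bases at two
distinct points of the same successor level are disjoint from each other. -/
def IsAdmissible : Prop :=
  ∃ 𝓑 : X → Set (Set X),
    (∀ x, (𝓝 x).HasBasis (fun V => V ∈ 𝓑 x) (fun V => V)) ∧
    ∀ β : Ordinal.{u}, β + 1 < cbHeight X →
      (∀ x ∈ cbLevel X (β + 1), ∃ U, IsAdmissibleBasis β x (𝓑 x) U) ∧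
      ∀ x ∈ cbLevel X (β + 1), ∀ y ∈ cbLevel X (β + 1), x ≠ y →
        ∀ U U', IsAdmissibleBasis β x (𝓑 x) U → IsAdmissibleBasis β y (𝓑 y) U' →
          ∀ ν μ, Disjoint (U ν) (U' μ)

/-- A good space: no level below the height is covered, up to a countable set, by countably
many Lindelöf clopen cones. -/
def IsGood : Prop :=
  ∀ α < cbHeight X, ∀ U : ℕ → Set X, (∀ n, ∃ x, IsLCCone (U n) x) →
    ¬ (cbLevel X α \ ⋃ n, U n).Countable

end Space

/-- The set of all ordinals below `ω₂`. -/
abbrev Omega2 : Type u := (ω_ 2 : Ordinal.{u}).ToType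

/-- The ordinal that an element of `Omega2` is. -/
noncomputable def val (x : Omega2.{u}) : Ordinal.{u} := (Ordinal.ToType.toOrd x).1

/-- The column `N_ξ = {ω₁ · μ + ξ : μ < ω₂}`. -/
def column (ξ : Ordinal.{u}) : Set Omega2.{u} :=
  {x | ∃ μ < (ω_ 2 : Ordinal.{u}), val x = ω_ 1 * μ + ξ}

end LLSP

/-!
The points of `ω₂` are arranged in levels `lev` (the blocks of length `ω₁`) and columns `col`, so
that each level has exactly one point in each of the `ω₁` columns. A point `x` is given the
neighbourhoods `basic W x η = {x} ∪ ⋃_{η ≤ ν} W x ν`, where `W x` is an `ω₁`-sequence of disjoint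
basic neighbourhoods of points of lower levels. The families `W x` are chosen by recursion on the
level of `x`. Since countable subsets of `ω₁` are bounded, every such topology is a P-space. If
moreover the families at each level are disjoint from each other and locally countable in the
union of the lower levels (`IsStage`), then basic neighbourhoods are clopen
(`exists_basic_subset`, `exists_disjoint_basic`) and Lindelöf (`isLindelof_basic`). The
Cantor–Bendixson levels are the prescribed ones if the points from which `W x` is built have
cofinal levels below `lev x` (`IsFull`).

The difficulty is to go on at levels of cofinality `ω`, where countably many Lindelöf sets might
cover all that has been built. This is excluded by a condition on columns: the set `W x ν` misses
all columns up to the `ν`-th. For a set `C` and a level `β`, the trace of `C` is the set of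
columns in which `C` has a point of level `β`. By the column condition the trace of `basic W x η`
is a diagonal union of the traces of the sets `W x ν`, up to the point `x`. As nonstationary
subsets of `ω₁` are closed under diagonal unions (`isSmall_diagonal`), an induction on the level
shows that all basic neighbourhoods, hence all Lindelöf sets, have nonstationary traces
(`isSmall_trace_basic`, `isSmall_trace_of_isLindelof`). Countably many of them therefore leave a
stationary part of every level uncovered. This gives goodness and the failure of the Lindelöf
property, and it is what makes the recursion possible at every level below `ω₂`: as there are only
`ω₁` points of lower level, one can choose `ω₁` tops, the points whose neighbourhoods make up the
new families, one after another, each outside the basic neighbourhoods of the earlier tops and of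
the points enumerated so far (`exists_tops`), and shrink their neighbourhoods to a disjoint,
locally countable family (`exists_separated_family`), which is then split among the `ω₁` new
points (`exists_extension`). The column condition also makes every column closed and discrete.
-/

namespace LLSP

/-! ### Countability in `ω₁` and nonstationary sets -/

/-- The set of all countable ordinals, indexing both the columns and the members of the
families that define neighbourhood bases. -/
abbrev Omega1 : Type (u + 1) := Set.Iio (ω_ 1 : Ordinal.{u})

instance : OrderBot Omega1.{u} where
  bot := ⟨0, Ordinal.omega_pos 1⟩
  bot_le a := zero_le (a := a.1)

theorem mk_omega1 : #Omega1.{u} = ℵ_ 1 := by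
  rw [Cardinal.mk_Iio_ordinal]; simp

theorem not_countable_omega1 : ¬ (univ : Set Omega1.{u}).Countable := by
  rw [← Cardinal.le_aleph0_iff_set_countable, Cardinal.mk_univ, mk_omega1, not_le]
  exact Cardinal.aleph0_lt_aleph_one

theorem countable_Iio_omega1 (k : Omega1.{u}) : (Iio k).Countable := by
  have h : (Iio k.1).Countable := by
    rw [← Cardinal.le_aleph0_iff_set_countable, Cardinal.mk_Iio_ordinal, Cardinal.lift_le_aleph0]
    have hk : k.1.card < ℵ_ 1 := by
      rw [← Cardinal.lt_ord, Cardinal.ord_aleph]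
      exact k.2
    rwa [← Cardinal.succ_aleph0, Order.lt_succ_iff] at hk
  exact (h.preimage Subtype.val_injective).mono fun x hx => hx

theorem countable_Iic_omega1 (k : Omega1.{u}) : (Iic k).Countable := by
  rw [← Iio_insert]
  exact (countable_Iio_omega1 k).insert k

theorem exists_forall_lt_of_countable {s : Set Omega1.{u}} (hs : s.Countable) :
    ∃ b, ∀ k ∈ s, k < b := by
  by_contra! h
  refine not_countable_omega1 ((hs.biUnion fun k _ => countable_Iic_omega1 k).mono ?_)
  intro b _
  obtain ⟨k, hk, hbk⟩ := h b
  exact mem_biUnion hk hbk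

/-- A set of countable ordinals that misses the closed unbounded set of nonzero ordinals closed
under some function `g`, that is, a nonstationary set. -/
def IsSmall (A : Set Omega1.{u}) : Prop :=
  ∃ g : Omega1.{u} → Omega1.{u}, ∀ δ ∈ A, δ = ⊥ ∨ ∃ ζ < δ, δ ≤ g ζ

theorem IsSmall.mono {A B : Set Omega1.{u}} (hB : IsSmall B) (h : A ⊆ B) : IsSmall A := by
  obtain ⟨g, hg⟩ := hB
  exact ⟨g, fun δ hδ => hg δ (h hδ)⟩

theorem isSmall_of_countable {A : Set Omega1.{u}} (hA : A.Countable) : IsSmall A := by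
  obtain ⟨b, hb⟩ := exists_forall_lt_of_countable hA
  refine ⟨fun _ => b, fun δ hδ => ?_⟩
  rcases eq_or_ne δ ⊥ with h | h
  · exact Or.inl h
  · exact Or.inr ⟨⊥, bot_lt_iff_ne_bot.2 h, (hb δ hδ).le⟩

/-- Nonstationary sets are closed under diagonal unions. -/
theorem isSmall_diagonal {A : Omega1.{u} → Set Omega1.{u}} (hA : ∀ ν, IsSmall (A ν))
    (hlt : ∀ ν, ∀ δ ∈ A ν, ν < δ) : IsSmall (⋃ ν, A ν) := by
  choose g hg using hA
  -- A bound for all values of the first `k` functions at the first `k` arguments.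
  have hb : ∀ k : Omega1.{u}, ∃ b, ∀ ν ≤ k, ∀ ζ ≤ k, g ν ζ < b := by
    intro k
    obtain ⟨b, hb⟩ := exists_forall_lt_of_countable
      (((countable_Iic_omega1 k).prod (countable_Iic_omega1 k)).image fun p => g p.1 p.2)
    exact ⟨b, fun ν hν ζ hζ => hb _ ⟨(ν, ζ), ⟨hν, hζ⟩, rfl⟩⟩
  choose G hG using hb
  refine ⟨G, fun δ hδ => ?_⟩
  obtain ⟨ν, hν⟩ := mem_iUnion.1 hδ
  refine (hg ν δ hν).imp_right ?_
  rintro ⟨ζ, hζ, hle⟩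
  exact ⟨max ν ζ, max_lt (hlt ν δ hν) hζ,
    hle.trans (hG _ ν (le_max_left _ _) ζ (le_max_right _ _)).le⟩

theorem isSmall_iUnion {ι : Type*} [Countable ι] {A : ι → Set Omega1.{u}}
    (hA : ∀ i, IsSmall (A i)) : IsSmall (⋃ i, A i) := by
  choose g hg using hA
  have hb : ∀ k : Omega1.{u}, ∃ b, ∀ i, g i k < b := by
    intro k
    obtain ⟨b, hb⟩ := exists_forall_lt_of_countable (countable_range fun i => g i k)
    exact ⟨b, fun i => hb _ ⟨i, rfl⟩⟩
  choose G hG using hb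
  refine ⟨G, fun δ hδ => ?_⟩
  obtain ⟨i, hi⟩ := mem_iUnion.1 hδ
  refine (hg i δ hi).imp_right ?_
  rintro ⟨ζ, hζ, hle⟩
  exact ⟨ζ, hζ, hle.trans (hG ζ i).le⟩

theorem isSmall_biUnion {ι : Type*} {s : Set ι} (hs : s.Countable) {A : ι → Set Omega1.{u}}
    (hA : ∀ i ∈ s, IsSmall (A i)) : IsSmall (⋃ i ∈ s, A i) := by
  have := hs.to_subtype
  rw [biUnion_eq_iUnion]
  exact isSmall_iUnion fun i => hA i.1 i.2

theorem IsSmall.union {A B : Set Omega1.{u}} (hA : IsSmall A) (hB : IsSmall B) :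
    IsSmall (A ∪ B) := by
  rw [union_eq_iUnion]
  exact isSmall_iUnion fun b => by cases b <;> assumption

theorem not_isSmall_univ : ¬ IsSmall (univ : Set Omega1.{u}) := by
  rintro ⟨g, hg⟩
  have hstep : ∀ k : Omega1.{u}, ∃ b, k < b ∧ ∀ ζ ≤ k, g ζ < b := by
    intro k
    obtain ⟨b, hb⟩ := exists_forall_lt_of_countable
      (((countable_Iic_omega1 k).image g).insert k)
    exact ⟨b, hb k (mem_insert _ _), fun ζ hζ => hb _ (mem_insert_of_mem _ ⟨ζ, hζ, rfl⟩)⟩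
  choose F hF hFg using hstep
  -- The supremum of the orbit of `⊥` under `F` is closed under `g`.
  let d : ℕ → Omega1.{u} := fun n => F^[n] ⊥
  have hd : ∀ n, d (n + 1) = F (d n) := fun n => Function.iterate_succ_apply' F n ⊥
  obtain ⟨b, hb⟩ := exists_forall_lt_of_countable (countable_range d)
  let S : Set Omega1.{u} := {b | ∀ n, d n < b}
  have hS : S.Nonempty := ⟨b, fun n => hb _ ⟨n, rfl⟩⟩
  obtain ⟨δ, hδ, hmin⟩ : ∃ δ ∈ S, ∀ ζ ∈ S, ¬ ζ < δ :=
    ⟨_, wellFounded_lt.min_mem S hS, fun ζ hζ => wellFounded_lt.not_lt_min S hζ⟩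
  rcases hg δ (mem_univ _) with h | ⟨ζ, hζ, hle⟩
  · exact absurd (hδ 0) (by rw [h]; exact not_lt_bot)
  · have : ζ ∉ S := fun h => hmin ζ h hζ
    simp only [S, mem_ofPred_eq, not_forall, not_lt] at this
    obtain ⟨n, hn⟩ := this
    have h1 : g ζ < d (n + 1) := by rw [hd]; exact hFg _ _ hn
    exact absurd (hle.trans_lt h1) (hδ (n + 1)).not_gt

theorem IsSmall.not_countable_compl {A : Set Omega1.{u}} (hA : IsSmall A) :
    ¬ (Aᶜ).Countable := fun h =>
  not_isSmall_univ (by simpa using hA.union (isSmall_of_countable h))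

/-! ### Recursion along a rank -/

/-- Construction by well-founded recursion on `lev`: if any function that is correct below rank
`i` can be altered at ranks `≥ i` so as to be correct at rank `i`, and if correctness at rank `i`
depends only on the values at ranks `≤ i`, then some function is correct at every rank. -/
theorem exists_forall_of_extend {P ι Y : Type*} [Nonempty Y] [LinearOrder ι] [WellFoundedLT ι]
    (lev : P → ι) (Q : ι → (P → Y) → Prop)
    (hcongr : ∀ i W W', (∀ x, lev x ≤ i → W x = W' x) → Q i W → Q i W')
    (hext : ∀ i W, (∀ j < i, Q j W) → ∃ W', (∀ x, lev x < i → W' x = W x) ∧ Q i W') :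
    ∃ W, ∀ i, Q i W := by
  classical
  have y₀ : Y := Classical.arbitrary Y
  let next : ι → (P → Y) → (P → Y) := fun i W =>
    if h : ∃ W', (∀ x, lev x < i → W' x = W x) ∧ Q i W' then h.choose else W
  have hnext : ∀ i W, (∀ j < i, Q j W) →
      (∀ x, lev x < i → next i W x = W x) ∧ Q i (next i W) := by
    intro i W hW
    have h := hext i W hW
    simp only [next, dif_pos h]
    exact h.choose_spec
  let G : ι → P → Y := wellFounded_lt.fix fun i ih =>
    next i fun x => if h : lev x < i then ih (lev x) h x else y₀
  have hG : ∀ i, G i = next i fun x => if lev x < i then G (lev x) x else y₀ := by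
    intro i
    simp only [G]
    rw [WellFounded.fix_eq]
    congr 1
  refine ⟨fun x => G (lev x) x, fun i => ?_⟩
  induction i using WellFoundedLT.induction with
  | ind i ih =>
    have h := hnext i (fun x => if lev x < i then G (lev x) x else y₀) fun j hj =>
      hcongr j _ _ (fun x hx => by rw [if_pos (hx.trans_lt hj)]) (ih j hj)
    rw [← hG] at h
    refine hcongr i _ _ (fun x hx => ?_) h.2
    rcases hx.lt_or_eq with hx | hx
    · rw [h.1 x hx, if_pos hx]
    · rw [hx]

/-! ### Levels and columns of `ω₂` -/

/-- The index `α` of the block `[ω₁ · α, ω₁ · (α + 1))` that contains `x`. -/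
noncomputable def lev (x : Omega2.{u}) : Ordinal.{u} := val x / ω_ 1

/-- The index of the column that contains `x`. -/
noncomputable def col (x : Omega2.{u}) : Omega1.{u} :=
  ⟨val x % ω_ 1, Ordinal.mod_lt _ (Ordinal.omega_pos 1).ne'⟩

theorem val_eq (x : Omega2.{u}) : val x = ω_ 1 * lev x + (col x).1 :=
  (Ordinal.div_add_mod _ _).symm

theorem val_injective : Function.Injective (val.{u}) := fun _ _ h =>
  Ordinal.ToType.mk.symm.injective (Subtype.ext h)

theorem eq_of_lev_col {x y : Omega2.{u}} (h : lev x = lev y) (h' : col x = col y) : x = y :=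
  val_injective (by rw [val_eq, val_eq, h, h'])

theorem val_lt (x : Omega2.{u}) : val x < ω_ 2 := (Ordinal.ToType.toOrd x).2

theorem lev_lt (x : Omega2.{u}) : lev x < ω_ 2 :=
  by
  refine lt_of_le_of_lt ?_ (val_lt x)
  conv_rhs => rw [val_eq x]
  exact (Ordinal.le_mul_right _ (Ordinal.omega_pos 1)).trans le_self_add

theorem val_lt_mul_iff {x : Omega2.{u}} {α : Ordinal.{u}} : val x < ω_ 1 * α ↔ lev x < α :=
  Ordinal.lt_mul_iff_div_lt (Ordinal.omega_pos 1).ne'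

theorem exists_point {α : Ordinal.{u}} (hα : α < ω_ 2) (k : Omega1.{u}) :
    ∃ x : Omega2.{u}, lev x = α ∧ col x = k := by
  have h12 : (ω_ 1 : Ordinal.{u}) < ω_ 2 := Ordinal.omega_lt_omega.2 (by norm_num)
  have hlt : ω_ 1 * α + k.1 < (ω_ 2 : Ordinal.{u}) :=
    Ordinal.isPrincipal_add_omega 2 (Ordinal.isPrincipal_mul_omega 2 h12 hα) (k.2.trans h12)
  have hv : val (Ordinal.ToType.mk ⟨_, hlt⟩ : Omega2.{u}) = ω_ 1 * α + k.1 := by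
    simp [val]
  refine ⟨Ordinal.ToType.mk ⟨_, hlt⟩, ?_, Subtype.ext ?_⟩
  · rw [lev, hv, Ordinal.mul_add_div _ (Ordinal.omega_pos 1).ne',
      Ordinal.div_eq_zero_of_lt k.2, add_zero]
  · change val _ % _ = _
    rw [hv, Ordinal.mul_add_mod_self, Ordinal.mod_eq_of_lt k.2]

theorem exists_range_eq_Iio {α : Ordinal.{u}} (hα : α < ω_ 2) (h0 : α ≠ 0) :
    ∃ c : Omega1.{u} → Ordinal.{u}, range c = Iio α := by
  have h : #(Iio α) ≤ #Omega1.{u} := by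
    have hc : α.card < ℵ_ 2 := by
      rw [← Cardinal.lt_ord, Cardinal.ord_aleph]
      exact hα
    have h2 : (2 : Ordinal.{u}) = Order.succ 1 := by
      rw [Order.succ_eq_add_one, one_add_one_eq_two]
    rw [h2, Order.succ_eq_add_one, ← Cardinal.succ_aleph, Order.lt_succ_iff] at hc
    rw [mk_omega1, Cardinal.mk_Iio_ordinal]
    simpa using Cardinal.lift_le.{u + 1}.2 hc
  obtain ⟨f⟩ := h
  have : Nonempty (Iio α) := ⟨⟨0, pos_iff_ne_zero.2 h0⟩⟩
  refine ⟨fun k => (Function.invFun f k).1, ?_⟩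
  ext β
  refine ⟨?_, fun hβ => ⟨f ⟨β, hβ⟩, ?_⟩⟩
  · rintro ⟨k, rfl⟩
    exact (Function.invFun f k).2
  · simp [Function.leftInverse_invFun f.injective _]

theorem nonempty_equiv_prod : Nonempty (Omega1.{u} ≃ Omega1.{u} × Omega1.{u}) := by
  apply Cardinal.eq.1
  rw [Cardinal.mk_prod, Cardinal.lift_id, Cardinal.mul_eq_self]
  rw [mk_omega1]
  exact Cardinal.aleph0_le_aleph 1

theorem exists_enum_lev_lt {α : Ordinal.{u}} (hα : α < ω_ 2) (h0 : α ≠ 0) :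
    ∃ e : Omega1.{u} → Omega2.{u}, range e = {x | lev x < α} := by
  obtain ⟨c, hc⟩ := exists_range_eq_Iio hα h0
  obtain ⟨p⟩ := nonempty_equiv_prod.{u}
  have hcα : ∀ k, c k < α := fun k => hc.subset (mem_range_self k)
  choose x hx hx' using fun k l : Omega1.{u} => exists_point ((hcα k).trans hα) l
  refine ⟨fun t => x (p t).1 (p t).2, ?_⟩
  ext z
  refine ⟨?_, fun hz => ?_⟩
  · rintro ⟨t, rfl⟩
    exact (hx _ _).trans_lt (hcα _)
  · obtain ⟨k, hk⟩ := hc.superset (show lev z ∈ Iio α from hz)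
    refine ⟨p.symm (k, col z), eq_of_lev_col ?_ ?_⟩
    · simp [hx, hk]
    · simp [hx']

/-- The levels of the tops to be used below a point of level `α`: all equal to the predecessor of
`α` if there is one, and otherwise such that each `β < α` occurs uncountably often. -/
theorem exists_cofinal_levels {α : Ordinal.{u}} (hα : α < ω_ 2) (h0 : α ≠ 0) :
    ∃ c : Omega1.{u} → Ordinal.{u}, (∀ ν, c ν < α) ∧
      (∀ β < α, ∀ η, ∃ ν, η ≤ ν ∧ β ≤ c ν) ∧ ∀ β, α = β + 1 → ∀ ν, c ν = β := by
  by_cases h : ∃ γ, α = γ + 1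
  · obtain ⟨γ, rfl⟩ := h
    refine ⟨fun _ => γ, fun _ => Order.lt_add_one_iff.2 le_rfl, fun β hβ η =>
      ⟨η, le_rfl, Order.lt_add_one_iff.1 hβ⟩, fun β hβ _ => ?_⟩
    exact Order.succ_injective (by simpa [Order.succ_eq_add_one] using hβ)
  · obtain ⟨c, hc⟩ := exists_range_eq_Iio hα h0
    obtain ⟨p⟩ := nonempty_equiv_prod.{u}
    refine ⟨fun ν => c (p ν).1, fun ν => hc.subset (mem_range_self _), fun β hβ η => ?_,
      fun β hβ => (h ⟨β, hβ⟩).elim⟩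
    obtain ⟨k, hk⟩ := hc.superset (show β ∈ Iio α from hβ)
    by_contra! hcon
    refine not_countable_omega1 (((countable_Iio_omega1 η).image fun ν => (p ν).2).mono ?_)
    intro l _
    refine ⟨p.symm (k, l), ?_, by simp⟩
    by_contra hη
    have := hcon _ (not_lt.1 hη)
    simp [hk] at this

/-! ### Neighbourhood systems and the topology they define -/

/-- The neighbourhood of `x` that consists of `x` and of the members, from the `η`-th on, of the
family `W x`. -/
def basic (W : Omega2.{u} → Omega1.{u} → Set Omega2.{u}) (x : Omega2.{u}) (η : Omega1.{u}) :
    Set Omega2.{u} :=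
  {x} ∪ ⋃ ν, ⋃ (_ : η ≤ ν), W x ν

/-- The conditions on the families `W x` for the points `x` of level `α`. They make the sets
`basic W x η` with `x` of level at most `α` clopen, provided that they hold at all lower levels
too. They involve `W` at levels at most `α` only. -/
structure IsStage (W : Omega2.{u} → Omega1.{u} → Set Omega2.{u}) (α : Ordinal.{u}) : Prop where
  /-- Each member is empty or a basic neighbourhood of a point of lower level. -/
  eq_empty_or_basic : ∀ x, lev x = α → ∀ ν,
    W x ν = ∅ ∨ ∃ y η, lev y < α ∧ W x ν = basic W y η
  /-- All members of all families of level `α` are pairwise disjoint. -/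
  disjoint : ∀ x y, lev x = α → lev y = α → ∀ ν μ, (x, ν) ≠ (y, μ) → Disjoint (W x ν) (W y μ)
  /-- The members of all families of level `α` are locally countable. -/
  countable : ∀ z, lev z < α →
    {p : Omega2.{u} × Omega1.{u} | lev p.1 = α ∧ ¬ Disjoint (basic W z ⊥) (W p.1 p.2)}.Countable
  /-- The `ν`-th member of a family misses all columns up to the `ν`-th. -/
  lt_col : ∀ x, lev x = α → ∀ ν, ∀ y ∈ W x ν, ν < col y

variable {W : Omega2.{u} → Omega1.{u} → Set Omega2.{u}}

theorem mem_basic {x z : Omega2.{u}} {η : Omega1.{u}} :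
    z ∈ basic W x η ↔ z = x ∨ ∃ ν, η ≤ ν ∧ z ∈ W x ν := by
  simp [basic]

theorem self_mem_basic (x : Omega2.{u}) (η : Omega1.{u}) : x ∈ basic W x η :=
  mem_basic.2 (Or.inl rfl)

theorem basic_anti (x : Omega2.{u}) : Antitone (basic W x) := by
  intro η η' h z hz
  rw [mem_basic] at hz ⊢
  exact hz.imp_right fun ⟨ν, hν, hz⟩ => ⟨ν, h.trans hν, hz⟩

theorem basic_congr {W' : Omega2.{u} → Omega1.{u} → Set Omega2.{u}} {x : Omega2.{u}}
    (h : W x = W' x) : basic W x = basic W' x := by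
  funext η
  simp only [basic, h]

theorem IsStage.congr {W' : Omega2.{u} → Omega1.{u} → Set Omega2.{u}} {α : Ordinal.{u}}
    (hW : IsStage W α) (h : ∀ x, lev x ≤ α → W x = W' x) : IsStage W' α where
  eq_empty_or_basic x hx ν := by
    rw [← h x hx.le]
    refine (hW.eq_empty_or_basic x hx ν).imp_right ?_
    rintro ⟨y, η, hy, hxy⟩
    exact ⟨y, η, hy, by rw [hxy, basic_congr (h y hy.le)]⟩
  disjoint x y hx hy := by
    rw [← h x hx.le, ← h y hy.le]
    exact hW.disjoint x y hx hy
  countable z hz := by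
    refine (hW.countable z hz).mono ?_
    rintro ⟨x, ν⟩ ⟨hx, hd⟩
    refine ⟨hx, ?_⟩
    rw [basic_congr (h z hz.le)]
    change ¬ Disjoint _ (W x ν)
    rw [h x (le_of_eq hx)]
    exact hd
  lt_col x hx := by
    rw [← h x hx.le]
    exact hW.lt_col x hx

theorem lev_induction {p : Omega2.{u} → Prop} (h : ∀ x, (∀ y, lev y < lev x → p y) → p x)
    (x : Omega2.{u}) : p x :=
  (InvImage.wf lev wellFounded_lt).induction x h

theorem exists_basic_disjoint_biUnion {ι : Type*} {s : Set ι} (hs : s.Countable)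
    {C : ι → Set Omega2.{u}} {x : Omega2.{u}}
    (h : ∀ i ∈ s, ∃ η, Disjoint (basic W x η) (C i)) :
    ∃ η, Disjoint (basic W x η) (⋃ i ∈ s, C i) := by
  have := hs.to_subtype
  choose η hη using fun i : s => h i.1 i.2
  obtain ⟨b, hb⟩ := exists_forall_lt_of_countable (countable_range η)
  refine ⟨b, disjoint_iUnion₂_right.2 fun i hi => ?_⟩
  exact (hη ⟨i, hi⟩).mono_left (basic_anti x (hb _ ⟨⟨i, hi⟩, rfl⟩).le)

section Stage

variable (hW : ∀ α, IsStage W α)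
include hW

theorem lev_lt_of_mem (x : Omega2.{u}) : ∀ ν, ∀ z ∈ W x ν, lev z < lev x := by
  induction x using lev_induction with
  | h x ih =>
    intro ν z hz
    rcases (hW _).eq_empty_or_basic x rfl ν with h | ⟨y, η, hy, h⟩
    · simp [h] at hz
    · rw [h, mem_basic] at hz
      rcases hz with rfl | ⟨μ, -, hz⟩
      · exact hy
      · exact (ih y hy μ z hz).trans hy

theorem eq_or_lev_lt_of_mem_basic {x z : Omega2.{u}} {η : Omega1.{u}} (hz : z ∈ basic W x η) :
    z = x ∨ lev z < lev x :=
  (mem_basic.1 hz).imp_right fun ⟨ν, _, h⟩ => lev_lt_of_mem hW x ν z h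

theorem lev_le_of_mem_basic {x z : Omega2.{u}} {η : Omega1.{u}} (hz : z ∈ basic W x η) :
    lev z ≤ lev x :=
  (eq_or_lev_lt_of_mem_basic hW hz).elim (fun h => h ▸ le_rfl) le_of_lt

theorem disjoint_basic_of_lev_eq {x z : Omega2.{u}} (hne : x ≠ z) (h : lev x = lev z)
    (η ζ : Omega1.{u}) : Disjoint (basic W x η) (basic W z ζ) := by
  rw [disjoint_left]
  intro y hy hy'
  rw [mem_basic] at hy hy'
  rcases hy with rfl | ⟨ν, -, hy⟩ <;> rcases hy' with rfl | ⟨μ, -, hy'⟩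
  · exact hne rfl
  · exact (lev_lt_of_mem hW z μ _ hy').ne h
  · exact (lev_lt_of_mem hW x ν _ hy).ne' h
  · exact disjoint_left.1 ((hW _).disjoint x z rfl h.symm ν μ fun h => hne (congrArg Prod.fst h))
      hy hy'

/-- Basic neighbourhoods are open. -/
theorem exists_basic_subset (x : Omega2.{u}) :
    ∀ η, ∀ z ∈ basic W x η, ∃ ζ, basic W z ζ ⊆ basic W x η := by
  induction x using lev_induction with
  | h x ih =>
    intro η z hz
    rcases mem_basic.1 hz with rfl | ⟨ν, hν, hzν⟩
    · exact ⟨η, Subset.rfl⟩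
    · have hsub : W x ν ⊆ basic W x η := fun y hy => mem_basic.2 (Or.inr ⟨ν, hν, hy⟩)
      rcases (hW _).eq_empty_or_basic x rfl ν with h | ⟨y, ξ, hy, h⟩
      · simp [h] at hzν
      · rw [h] at hzν hsub
        obtain ⟨ζ, hζ⟩ := ih y hy ξ z hzν
        exact ⟨ζ, hζ.trans hsub⟩

theorem countable_not_disjoint {x z : Omega2.{u}} (h : lev z < lev x) :
    {ν | ¬ Disjoint (basic W z ⊥) (W x ν)}.Countable := by
  refine (((hW _).countable z h).preimage (Prod.mk_right_injective x)).mono fun ν hν => ?_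
  exact ⟨rfl, hν⟩

/-- Basic neighbourhoods are closed. -/
theorem exists_disjoint_basic (x : Omega2.{u}) :
    ∀ η, ∀ z ∉ basic W x η, ∃ ζ, Disjoint (basic W z ζ) (basic W x η) := by
  induction x using lev_induction with
  | h x ih =>
    intro η z hz
    have hne : z ≠ x := fun h => hz (h ▸ self_mem_basic _ _)
    rcases lt_trichotomy (lev z) (lev x) with hlt | heq | hgt
    · -- Only countably many members of the family of `x` come near `z`, and each is closed.
      have hc : {ν | η ≤ ν ∧ ¬ Disjoint (basic W z ⊥) (W x ν)}.Countable :=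
        (countable_not_disjoint hW hlt).mono fun ν hν => hν.2
      obtain ⟨ζ, hζ⟩ := exists_basic_disjoint_biUnion (W := W) (x := z) (C := W x) hc (by
        rintro ν ⟨hν, -⟩
        have hzν : z ∉ W x ν := fun h => hz (mem_basic.2 (Or.inr ⟨ν, hν, h⟩))
        rcases (hW _).eq_empty_or_basic x rfl ν with h | ⟨y, ξ, hy, h⟩
        · exact ⟨⊥, by simp [h]⟩
        · rw [h] at hzν ⊢
          exact ih y hy ξ z hzν)
      refine ⟨ζ, disjoint_left.2 fun y hy hy' => ?_⟩
      rcases mem_basic.1 hy' with rfl | ⟨ν, hν, hyν⟩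
      · exact (lev_le_of_mem_basic hW hy).not_gt hlt
      · have hd : ¬ Disjoint (basic W z ⊥) (W x ν) :=
          not_disjoint_iff.2 ⟨y, basic_anti z bot_le hy, hyν⟩
        exact disjoint_left.1 hζ hy (mem_biUnion (show ν ∈ {ν | _} from ⟨hν, hd⟩) hyν)
    · exact ⟨⊥, disjoint_basic_of_lev_eq hW hne heq _ _⟩
    · have hc : {ν | ¬ Disjoint (basic W x ⊥) (W z ν)}.Countable :=
        countable_not_disjoint hW hgt
      obtain ⟨ζ, hζ⟩ := exists_forall_lt_of_countable hc
      refine ⟨ζ, disjoint_left.2 fun y hy hy' => ?_⟩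
      rcases mem_basic.1 hy with rfl | ⟨ν, hν, hyν⟩
      · exact (lev_le_of_mem_basic hW hy').not_gt hgt
      · exact (hζ ν (not_disjoint_iff.2 ⟨y, basic_anti x bot_le hy', hyν⟩)).not_ge hν

theorem exists_not_mem_basic {x z : Omega2.{u}} (hne : z ≠ x) : ∃ η, z ∉ basic W x η := by
  by_cases h : ∃ ν, z ∈ W x ν
  · obtain ⟨ν, hν⟩ := h
    obtain ⟨η, hη⟩ := exists_forall_lt_of_countable (countable_singleton ν)
    refine ⟨η, fun hz => ?_⟩
    obtain ⟨μ, hμ, hzμ⟩ := (mem_basic.1 hz).resolve_left hne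
    have : μ ≠ ν := ((hη ν rfl).trans_le hμ).ne'
    exact disjoint_left.1 ((hW _).disjoint x x rfl rfl μ ν fun h => this (congrArg Prod.snd h))
      hzμ hν
  · exact ⟨⊥, fun hz => h (((mem_basic.1 hz).resolve_left hne).imp fun _ h => h.2)⟩

/-- Every point has a basic neighbourhood that meets a given column in no other point. -/
theorem exists_basic_col_ne (x : Omega2.{u}) (k : Omega1.{u}) :
    ∃ η, ∀ y ∈ basic W x η, col y ≤ k → y = x := by
  refine ⟨k, fun y hy hk => (mem_basic.1 hy).resolve_right ?_⟩
  rintro ⟨ν, hν, hyν⟩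
  exact (hν.trans_lt ((hW _).lt_col x rfl ν y hyν)).not_ge hk

end Stage

/-! ### Traces on the levels -/

/-- The set of columns in which `C` has a point of level `β`. -/
def trace (C : Set Omega2.{u}) (β : Ordinal.{u}) : Set Omega1.{u} :=
  col '' {y ∈ C | lev y = β}

theorem trace_mono {C D : Set Omega2.{u}} (h : C ⊆ D) (β : Ordinal.{u}) :
    trace C β ⊆ trace D β :=
  image_mono fun _ hy => ⟨h hy.1, hy.2⟩

theorem trace_biUnion_subset {ι : Type*} (s : Set ι) (C : ι → Set Omega2.{u}) (β : Ordinal.{u}) :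
    trace (⋃ i ∈ s, C i) β ⊆ ⋃ i ∈ s, trace (C i) β := by
  rintro _ ⟨y, ⟨hy, hβ⟩, rfl⟩
  obtain ⟨i, hi, hyi⟩ := mem_iUnion₂.1 hy
  exact mem_biUnion hi ⟨y, ⟨hyi, hβ⟩, rfl⟩

/-- Basic neighbourhoods have nonstationary traces. The family of `x` avoids initial columns, so
the trace of its union is a diagonal union of the traces of its members. -/
theorem isSmall_trace_basic (hW : ∀ α, IsStage W α) (x : Omega2.{u}) :
    ∀ η β, IsSmall (trace (basic W x η) β) := by
  induction x using lev_induction with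
  | h x ih =>
    intro η β
    have hsub : trace (basic W x η) β ⊆ {col x} ∪ ⋃ ν, trace (W x ν) β := by
      rintro _ ⟨y, ⟨hy, hβ⟩, rfl⟩
      rcases mem_basic.1 hy with rfl | ⟨ν, -, hν⟩
      · exact Or.inl rfl
      · exact Or.inr (mem_iUnion.2 ⟨ν, y, ⟨hν, hβ⟩, rfl⟩)
    refine ((isSmall_of_countable (countable_singleton _)).union
      (isSmall_diagonal (fun ν => ?_) ?_)).mono hsub
    · rcases (hW _).eq_empty_or_basic x rfl ν with h | ⟨y, ξ, hy, h⟩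
      · exact isSmall_of_countable (by simp [h, trace])
      · rw [h]
        exact ih y hy ξ β
    · rintro ν _ ⟨y, ⟨hy, -⟩, rfl⟩
      exact (hW _).lt_col x rfl ν y hy

theorem isSmall_trace_biUnion_basic (hW : ∀ α, IsStage W α) {s : Set Omega2.{u}}
    (hs : s.Countable) (β : Ordinal.{u}) : IsSmall (trace (⋃ x ∈ s, basic W x ⊥) β) :=
  (isSmall_biUnion hs fun x _ => isSmall_trace_basic hW x ⊥ β).mono (trace_biUnion_subset _ _ _)

/-! ### The topology of a neighbourhood system -/

theorem exists_topology (hW : ∀ α, IsStage W α) :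
    ∃ _ : TopologicalSpace Omega2.{u}, ∀ x, (𝓝 x).HasBasis (fun _ => True) (basic W x) := by
  let n : Omega2.{u} → Filter Omega2.{u} := fun x => ⨅ η, 𝓟 (basic W x η)
  have hn : ∀ x, (n x).HasBasis (fun _ => True) (basic W x) := fun x =>
    hasBasis_iInf_principal (basic_anti x).directed_ge
  refine ⟨TopologicalSpace.mkOfNhds n, fun x => ?_⟩
  rw [TopologicalSpace.nhds_mkOfNhds_of_hasBasis hn (fun x η _ => self_mem_basic x η)]
  · exact hn x
  · intro x η _
    refine (hn x).mem_iff.2 ⟨η, trivial, fun z hz => ?_⟩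
    obtain ⟨ζ, hζ⟩ := exists_basic_subset hW x η z hz
    exact (hn z).mem_iff.2 ⟨ζ, trivial, hζ⟩

section Topology

variable [TopologicalSpace Omega2.{u}]
  (hb : ∀ x : Omega2.{u}, (𝓝 x).HasBasis (fun _ => True) (basic W x))
include hb

theorem isOpen_iff_basic {O : Set Omega2.{u}} :
    IsOpen O ↔ ∀ x ∈ O, ∃ η, basic W x η ⊆ O := by
  simp only [isOpen_iff_mem_nhds, (hb _).mem_iff, true_and]

theorem basic_mem_nhds (x : Omega2.{u}) (η : Omega1.{u}) : basic W x η ∈ 𝓝 x :=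
  (hb x).mem_of_mem trivial

theorem isPSpace : IsPSpace Omega2.{u} := by
  intro S hS hO
  rw [isOpen_iff_basic hb]
  intro x hx
  obtain ⟨η, hη⟩ := exists_basic_disjoint_biUnion (W := W) (x := x) (C := fun U => Uᶜ) hS (by
    intro U hU
    obtain ⟨η, hη⟩ := (isOpen_iff_basic hb).1 (hO U hU) x (hx U hU)
    exact ⟨η, disjoint_compl_right_iff_subset.2 hη⟩)
  refine ⟨η, fun y hy U hU => ?_⟩
  by_contra hyU
  exact disjoint_left.1 hη hy (mem_biUnion hU hyU)

theorem isClopen_basic (hW : ∀ α, IsStage W α) (x : Omega2.{u}) (η : Omega1.{u}) :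
    IsClopen (basic W x η) := by
  constructor
  · rw [← isOpen_compl_iff, isOpen_iff_basic hb]
    intro z hz
    obtain ⟨ζ, hζ⟩ := exists_disjoint_basic hW x η z hz
    exact ⟨ζ, disjoint_left.1 hζ⟩
  · rw [isOpen_iff_basic hb]
    exact exists_basic_subset hW x η

theorem isClosed_column (hW : ∀ α, IsStage W α) (k : Omega1.{u}) :
    IsClosed {x : Omega2.{u} | col x = k} ∧ IsDiscrete {x : Omega2.{u} | col x = k} := by
  constructor
  · rw [← isOpen_compl_iff, isOpen_iff_basic hb]
    intro x hx
    obtain ⟨η, hη⟩ := exists_basic_col_ne hW x k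
    exact ⟨η, fun y hy hyk => hx (hη y hy (le_of_eq hyk) ▸ hyk)⟩
  · rw [isDiscrete_iff_forall_mem_exists_isOpen]
    intro x hx
    obtain ⟨η, hη⟩ := exists_basic_col_ne hW x k
    refine ⟨_, (isClopen_basic hb hW x η).isOpen, ?_⟩
    ext y
    constructor
    · rintro ⟨hy, hyk⟩
      exact hη y hy (le_of_eq hyk)
    · rintro rfl
      exact ⟨self_mem_basic y η, hx⟩

theorem isLindelof_basic (hW : ∀ α, IsStage W α) (x : Omega2.{u}) :
    ∀ η, IsLindelof (basic W x η) := by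
  induction x using lev_induction with
  | h x ih =>
    intro η
    refine isLindelof_of_countable_subcover fun {ι} U hU hsub => ?_
    obtain ⟨i, hi⟩ := mem_iUnion.1 (hsub (self_mem_basic x η))
    obtain ⟨ζ, hζ⟩ := (isOpen_iff_basic hb).1 (hU i) x hi
    -- What is left uncovered by `U i` lies in countably many members of the family of `x`.
    have hL : IsLindelof (⋃ ν ∈ {ν | η ≤ ν ∧ ν < ζ}, W x ν) := by
      refine ((countable_Iio_omega1 ζ).mono fun ν hν => hν.2).isLindelof_biUnion fun ν _ => ?_
      rcases (hW _).eq_empty_or_basic x rfl ν with h | ⟨y, ξ, hy, h⟩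
      · rw [h]; exact isLindelof_empty
      · rw [h]; exact ih y hy ξ
    obtain ⟨r, hr, hcov⟩ := hL.elim_countable_subcover U hU (by
      refine Subset.trans (iUnion₂_subset fun ν hν => ?_) hsub
      exact fun y hy => mem_basic.2 (Or.inr ⟨ν, hν.1, hy⟩))
    refine ⟨insert i r, hr.insert i, fun y hy => ?_⟩
    by_cases hyi : y ∈ basic W x ζ
    · exact mem_biUnion (mem_insert _ _) (hζ hyi)
    · rcases mem_basic.1 hy with rfl | ⟨ν, hν, hyν⟩
      · exact absurd (self_mem_basic y ζ) hyi
      · have hνζ : ν < ζ := not_le.1 fun h => hyi (mem_basic.2 (Or.inr ⟨ν, h, hyν⟩))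
        obtain ⟨j, hj, hyj⟩ := mem_iUnion₂.1
          (hcov (mem_biUnion (show ν ∈ {ν | _} from ⟨hν, hνζ⟩) hyν))
        exact mem_biUnion (mem_insert_of_mem _ hj) hyj

theorem t2Space (hW : ∀ α, IsStage W α) : T2Space Omega2.{u} := by
  refine ⟨fun x z hne => ?_⟩
  obtain ⟨η, hη⟩ := exists_not_mem_basic hW hne.symm
  have h := isClopen_basic hb hW x η
  exact ⟨_, _, h.isOpen, h.compl.isOpen, self_mem_basic x η, hη, disjoint_compl_right⟩

/-- Lindelöf sets have nonstationary traces, being covered by countably many basic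
neighbourhoods. -/
theorem isSmall_trace_of_isLindelof (hW : ∀ α, IsStage W α) {C : Set Omega2.{u}}
    (hC : IsLindelof C) (β : Ordinal.{u}) : IsSmall (trace C β) := by
  obtain ⟨r, hr, hsub⟩ := hC.elim_countable_subcover (fun x => basic W x ⊥)
    (fun x => (isClopen_basic hb hW x ⊥).isOpen)
    fun x _ => mem_iUnion.2 ⟨x, self_mem_basic x ⊥⟩
  exact (isSmall_trace_biUnion_basic hW hr β).mono (trace_mono hsub β)

theorem not_isLindelof_lev_lt (hW : ∀ α, IsStage W α) {α : Ordinal.{u}} (h0 : α ≠ 0) :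
    ¬ IsLindelof {x : Omega2.{u} | lev x < α} := by
  intro h
  refine not_isSmall_univ ((isSmall_trace_of_isLindelof hb hW h 0).mono fun k _ => ?_)
  obtain ⟨x, hx, hk⟩ := exists_point (Ordinal.omega_pos 2) k
  exact ⟨x, ⟨hx.trans_lt (pos_iff_ne_zero.2 h0), hx⟩, hk⟩

end Topology

/-! ### Adding a level -/

/-- The points of level `α` are limits of the levels below `α`: the members of their families are
basic neighbourhoods of points of cofinal levels, and of level `β` if `α = β + 1`. -/
structure IsFull (W : Omega2.{u} → Omega1.{u} → Set Omega2.{u}) (α : Ordinal.{u}) : Prop where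
  exists_of_lt : ∀ x, lev x = α → ∀ β < α, ∀ η, ∃ ν, η ≤ ν ∧
    ∃ y ζ, β ≤ lev y ∧ lev y < α ∧ W x ν = basic W y ζ
  exists_of_eq_add_one : ∀ x, lev x = α → ∀ β, α = β + 1 → ∀ ν,
    ∃ y ζ, lev y = β ∧ W x ν = basic W y ζ

theorem IsFull.congr {W' : Omega2.{u} → Omega1.{u} → Set Omega2.{u}} {α : Ordinal.{u}}
    (hW : IsFull W α) (h : ∀ x, lev x ≤ α → W x = W' x) : IsFull W' α where
  exists_of_lt x hx β hβ η := by
    obtain ⟨ν, hν, y, ζ, hy, hyα, hxy⟩ := hW.exists_of_lt x hx β hβ η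
    exact ⟨ν, hν, y, ζ, hy, hyα, by rw [← h x hx.le, hxy, basic_congr (h y hyα.le)]⟩
  exists_of_eq_add_one x hx β hβ ν := by
    obtain ⟨y, ζ, hy, hxy⟩ := hW.exists_of_eq_add_one x hx β hβ ν
    have hyα : lev y ≤ α := by rw [hy, hβ]; exact le_self_add
    exact ⟨y, ζ, hy, by rw [← h x hx.le, hxy, basic_congr (h y hyα)]⟩

theorem isStage_of_eq_empty {α : Ordinal.{u}} (h : ∀ x, lev x = α → ∀ ν, W x ν = ∅) :
    IsStage W α where
  eq_empty_or_basic x hx ν := Or.inl (h x hx ν)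
  disjoint x y hx _ ν μ _ := by simp [h x hx ν]
  countable z _ := by
    convert countable_empty
    rw [eq_empty_iff_forall_notMem]
    rintro ⟨x, ν⟩ ⟨hx, hd⟩
    exact hd (by simp [h x hx ν])
  lt_col x hx ν y hy := by simp [h x hx ν] at hy

/-- Goodness in the form used to add a level: a level is not covered by countably many basic
neighbourhoods and countably many columns. -/
theorem exists_not_mem_basic_of_countable (hW : ∀ α, IsStage W α) {α : Ordinal.{u}}
    (hα : α < ω_ 2) (ν : Omega1.{u}) {s : Set Omega2.{u}} (hs : s.Countable) :
    ∃ z, lev z = α ∧ ν < col z ∧ ∀ x ∈ s, z ∉ basic W x ⊥ := by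
  have hsmall := (isSmall_trace_biUnion_basic hW hs α).union
    (isSmall_of_countable (countable_Iic_omega1 ν))
  obtain ⟨k, hk⟩ : ∃ k, k ∉ trace (⋃ x ∈ s, basic W x ⊥) α ∪ Iic ν := by
    by_contra! h
    exact not_isSmall_univ (hsmall.mono fun k _ => h k)
  rw [mem_union, not_or] at hk
  obtain ⟨z, hz, rfl⟩ := exists_point hα k
  exact ⟨z, hz, not_le.1 hk.2, fun x hx hzx => hk.1 ⟨z, ⟨mem_biUnion hx hzx, hz⟩, rfl⟩⟩

/-- A sequence of tops with levels and columns prescribed by `c` and `d`, each avoiding the basic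
neighbourhoods of the previous tops and of the previous points of the enumeration `e`. -/
theorem exists_tops (hW : ∀ α, IsStage W α) (e : Omega1.{u} → Omega2.{u})
    (c : Omega1.{u} → Ordinal.{u}) (hc : ∀ s, c s < ω_ 2) (d : Omega1.{u} → Omega1.{u}) :
    ∃ y : Omega1.{u} → Omega2.{u}, ∀ s, lev (y s) = c s ∧ d s < col (y s) ∧
      ∀ x ∈ e '' Iio s ∪ y '' Iio s, y s ∉ basic W x ⊥ := by
  have : Nonempty Omega2.{u} := ⟨e ⊥⟩
  refine exists_forall_of_extend (P := Omega1.{u}) id (fun s y => lev (y s) = c s ∧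
    d s < col (y s) ∧ ∀ x ∈ e '' Iio s ∪ y '' Iio s, y s ∉ basic W x ⊥) ?_ ?_
  · intro s y y' h hy
    have h1 : y '' Iio s = y' '' Iio s := image_congr fun t ht => h t (le_of_lt ht)
    rwa [← h1, ← h s le_rfl]
  · intro s y _
    have hs := ((countable_Iio_omega1 s).image e).union ((countable_Iio_omega1 s).image y)
    obtain ⟨z, hz⟩ := exists_not_mem_basic_of_countable hW (hc s) (d s) hs
    refine ⟨Function.update y s z, fun t ht => Function.update_of_ne (ne_of_lt ht) _ _, ?_⟩
    have h1 : Function.update y s z '' Iio s = y '' Iio s :=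
      image_congr fun t ht => Function.update_of_ne (ne_of_lt ht) _ _
    rw [h1, Function.update_self]
    exact hz

/-- Each top has a basic neighbourhood disjoint from those of the previous points of the
enumeration and of the previous tops, and missing the prescribed initial columns. -/
theorem exists_separated_family (hW : ∀ α, IsStage W α) (e : Omega1.{u} → Omega2.{u})
    (c : Omega1.{u} → Ordinal.{u}) (hc : ∀ s, c s < ω_ 2) (d : Omega1.{u} → Omega1.{u}) :
    ∃ (y : Omega1.{u} → Omega2.{u}) (ζ : Omega1.{u} → Omega1.{u}), ∀ s, lev (y s) = c s ∧
      (∀ z ∈ basic W (y s) (ζ s), d s < col z) ∧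
      (∀ t < s, Disjoint (basic W (e t) ⊥) (basic W (y s) (ζ s))) ∧
      ∀ t < s, Disjoint (basic W (y t) (ζ t)) (basic W (y s) (ζ s)) := by
  obtain ⟨y, hy⟩ := exists_tops hW e c hc d
  have hζ : ∀ s, ∃ ζ, (∀ z ∈ basic W (y s) ζ, d s < col z) ∧
      ∀ x ∈ e '' Iio s ∪ y '' Iio s, Disjoint (basic W x ⊥) (basic W (y s) ζ) := by
    intro s
    have hs := ((countable_Iio_omega1 s).image e).union ((countable_Iio_omega1 s).image y)
    obtain ⟨ζ₁, h₁⟩ := exists_basic_col_ne hW (y s) (d s)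
    obtain ⟨ζ₂, h₂⟩ := exists_basic_disjoint_biUnion (C := fun x => basic W x ⊥) (x := y s) hs
      fun x hx => exists_disjoint_basic hW x ⊥ (y s) ((hy s).2.2 x hx)
    refine ⟨max ζ₁ ζ₂, fun z hz => ?_, fun x hx => ?_⟩
    · by_contra hcol
      have := h₁ z (basic_anti _ (le_max_left _ _) hz) (not_lt.1 hcol)
      exact hcol (this ▸ (hy s).2.1)
    · exact ((disjoint_iUnion₂_right.1 h₂ x hx).mono_left
        (basic_anti _ (le_max_right _ _))).symm
  choose ζ hcol hdisj using hζ
  refine ⟨y, ζ, fun s => ⟨(hy s).1, hcol s, fun t ht => ?_, fun t ht => ?_⟩⟩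
  · exact hdisj s _ (Or.inl ⟨t, ht, rfl⟩)
  · exact (hdisj s _ (Or.inr ⟨t, ht, rfl⟩)).mono_left (basic_anti _ bot_le)

theorem exists_extension (hW : ∀ β, IsStage W β) {α : Ordinal.{u}} (hα : α < ω_ 2) (h0 : α ≠ 0) :
    ∃ W' : Omega2.{u} → Omega1.{u} → Set Omega2.{u}, (∀ x, lev x < α → W' x = W x) ∧
      IsStage W' α ∧ IsFull W' α := by
  classical
  obtain ⟨e, he⟩ := exists_enum_lev_lt hα h0
  obtain ⟨c, hcα, hc, hc'⟩ := exists_cofinal_levels hα h0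
  obtain ⟨p⟩ := nonempty_equiv_prod.{u}
  obtain ⟨y, ζ, hy⟩ := exists_separated_family hW e (fun s => c (p s).2)
    (fun s => (hcα _).trans hα) fun s => (p s).2
  -- The separated family is split into `ω₁` families, one for each new point.
  let F : Omega2.{u} → Omega1.{u} → Omega1.{u} := fun x ν => p.symm (col x, ν)
  let U : Omega1.{u} → Set Omega2.{u} := fun s => basic W (y s) (ζ s)
  let W' : Omega2.{u} → Omega1.{u} → Set Omega2.{u} := fun x =>
    if lev x = α then fun ν => U (F x ν) else W x
  have hlt : ∀ x, lev x < α → W' x = W x := fun x hx => if_neg hx.ne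
  have heq : ∀ x, lev x = α → ∀ ν, W' x ν = U (F x ν) := fun x hx ν => by
    simp only [W', if_pos hx]
  have hpF : ∀ x ν, p (F x ν) = (col x, ν) := fun x ν => p.apply_symm_apply _
  have hF : ∀ x z, lev x = α → lev z = α → ∀ ν μ, F x ν = F z μ → (x, ν) = (z, μ) := by
    intro x z hx hz ν μ h
    have := p.symm.injective h
    rw [Prod.mk.injEq] at this
    rw [eq_of_lev_col (hx.trans hz.symm) this.1, this.2]
  have hlev : ∀ x ν, lev (y (F x ν)) = c ν := fun x ν => by rw [(hy _).1, hpF]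
  have hbasic : ∀ x, lev x = α → ∀ ν, W' x ν = basic W' (y (F x ν)) (ζ (F x ν)) := by
    intro x hx ν
    rw [heq x hx, basic_congr (hlt _ ((hlev x ν).trans_lt (hcα ν)))]
  refine ⟨W', hlt, ⟨fun x hx ν => ?_, fun x z hx hz ν μ hne => ?_, fun z hz => ?_,
    fun x hx ν z hz => ?_⟩, ⟨fun x hx β hβ η => ?_, fun x hx β hβ ν => ?_⟩⟩
  · exact Or.inr ⟨_, _, (hlev x ν).trans_lt (hcα ν), hbasic x hx ν⟩
  · rw [heq x hx, heq z hz]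
    rcases lt_or_gt_of_ne fun h => hne (hF x z hx hz ν μ h) with h | h
    · exact (hy _).2.2.2 _ h
    · exact ((hy _).2.2.2 _ h).symm
  · obtain ⟨t, rfl⟩ := he.superset hz
    have hinj : InjOn (fun q : Omega2.{u} × Omega1.{u} => F q.1 q.2) {q | lev q.1 = α} :=
      fun q hq r hr h => hF q.1 r.1 hq hr q.2 r.2 h
    refine countable_of_injective_of_countable_image (f := fun q => F q.1 q.2)
      (hinj.mono fun q hq => hq.1) ((countable_Iic_omega1 t).mono ?_)
    rintro _ ⟨⟨x, ν⟩, ⟨hx, hd⟩, rfl⟩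
    by_contra hts
    refine hd ?_
    change Disjoint _ (W' x ν)
    rw [heq x hx, basic_congr (hlt _ hz)]
    exact (hy _).2.2.1 t (not_le.1 hts)
  · rw [heq x hx] at hz
    have := (hy _).2.1 z hz
    rwa [hpF] at this
  · obtain ⟨ν, hν, hβν⟩ := hc β hβ η
    exact ⟨ν, hν, _, _, hβν.trans_eq (hlev x ν).symm, (hlev x ν).trans_lt (hcα ν), hbasic x hx ν⟩
  · exact ⟨_, _, (hlev x ν).trans (hc' β hβ ν), hbasic x hx ν⟩

theorem exists_neighbourhood_system :
    ∃ W : Omega2.{u} → Omega1.{u} → Set Omega2.{u}, (∀ α, IsStage W α) ∧ ∀ α, IsFull W α := by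
  classical
  have key := exists_forall_of_extend (Y := Omega1.{u} → Set Omega2.{u}) lev
    (fun α W => IsStage W α ∧ IsFull W α)
    (fun α W W' h hW => ⟨hW.1.congr h, hW.2.congr h⟩) ?_
  · obtain ⟨W, hW⟩ := key
    exact ⟨W, fun α => (hW α).1, fun α => (hW α).2⟩
  · intro α W hW
    -- The truncation of `W` below level `α` satisfies the stage conditions at all levels.
    let V : Omega2.{u} → Omega1.{u} → Set Omega2.{u} := fun x =>
      if lev x < α then W x else fun _ => ∅
    have hVW : ∀ x, lev x < α → V x = W x := fun x hx => if_pos hx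
    have hV0 : ∀ x, α ≤ lev x → ∀ ν, V x ν = ∅ := fun x hx ν => by
      simp only [V, if_neg hx.not_gt]
    have hV : ∀ β, IsStage V β := by
      intro β
      rcases lt_or_ge β α with h | h
      · exact (hW β h).1.congr fun x hx => (hVW x (hx.trans_lt h)).symm
      · exact isStage_of_eq_empty fun x hx => hV0 x (h.trans_eq hx.symm)
    by_cases h0 : α = 0
    · refine ⟨V, hVW, hV α, fun x _ β hβ => ?_, fun x _ β hβ => ?_⟩
      · simp [h0] at hβ
      · have h : β < α := hβ ▸ Order.lt_add_one_iff.2 le_rfl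
        simp [h0] at h
    by_cases hα : α < ω_ 2
    · obtain ⟨W', hlt, hW'⟩ := exists_extension hV hα h0
      exact ⟨W', fun x hx => (hlt x hx).trans (hVW x hx), hW'⟩
    · exact ⟨V, hVW, hV α, fun x hx => (hα (hx ▸ lev_lt x)).elim,
        fun x hx => (hα (hx ▸ lev_lt x)).elim⟩

/-! ### Cantor–Bendixson levels and verification of the properties -/

section Levels

variable [TopologicalSpace Omega2.{u}]
  (hb : ∀ x : Omega2.{u}, (𝓝 x).HasBasis (fun _ => True) (basic W x))
  (hW : ∀ α, IsStage W α) (hF : ∀ α, IsFull W α)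
include hb hW hF

theorem accPt_lev_ge_iff {x : Omega2.{u}} {α : Ordinal.{u}} :
    AccPt x (𝓟 {y | α ≤ lev y}) ↔ α < lev x := by
  rw [accPt_iff_nhds]
  constructor
  · intro h
    obtain ⟨y, ⟨hy, hαy⟩, hne⟩ := h _ (basic_mem_nhds hb x ⊥)
    exact hαy.trans_lt ((eq_or_lev_lt_of_mem_basic hW hy).resolve_left hne)
  · intro h U hU
    obtain ⟨η, -, hη⟩ := (hb x).mem_iff.1 hU
    obtain ⟨ν, hν, y, ζ, hαy, hyx, hxν⟩ := (hF _).exists_of_lt x rfl α h η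
    refine ⟨y, ⟨hη (mem_basic.2 (Or.inr ⟨ν, hν, ?_⟩)), hαy⟩, fun h => hyx.ne (congrArg lev h)⟩
    rw [hxν]
    exact self_mem_basic y ζ

theorem cbDeriv_eq (α : Ordinal.{u}) : cbDeriv Omega2.{u} α = {x | α ≤ lev x} := by
  unfold cbDeriv
  induction α using Ordinal.limitRecOn with
  | zero => simp
  | add_one α ih =>
    rw [CantorBendixson.iteratedDerivedSet_succ, ih]
    ext x
    change AccPt x (𝓟 {y | α ≤ lev y}) ∧ α ≤ lev x ↔ α + 1 ≤ lev x
    rw [accPt_lev_ge_iff hb hW hF, Order.add_one_le_iff]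
    exact and_iff_left_of_imp le_of_lt
  | limit α hα ih =>
    rw [CantorBendixson.iteratedDerivedSet_limit hα]
    ext x
    simp only [mem_iInter, mem_ofPred_eq]
    constructor
    · intro h
      by_contra hx
      rw [not_le] at hx
      have h1 := h ⟨lev x + 1, hα.add_one_lt hx⟩
      rw [ih _ (hα.add_one_lt hx)] at h1
      exact (Order.lt_add_one_iff.2 le_rfl).not_ge (show lev x + 1 ≤ lev x from h1)
    · rintro h ⟨β, hβ⟩
      rw [ih β hβ]
      exact (le_of_lt hβ).trans h

theorem cbLevel_eq (α : Ordinal.{u}) : cbLevel Omega2.{u} α = {x | lev x = α} := by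
  rw [cbLevel, cbDeriv_eq hb hW hF, cbDeriv_eq hb hW hF]
  ext x
  change α ≤ lev x ∧ ¬ α + 1 ≤ lev x ↔ lev x = α
  rw [Order.add_one_le_iff, not_lt]
  exact ⟨fun h => le_antisymm h.2 h.1, fun h => ⟨h.ge, h.le⟩⟩

theorem cbDeriv_eq_empty_iff {α : Ordinal.{u}} : cbDeriv Omega2.{u} α = ∅ ↔ ω_ 2 ≤ α := by
  rw [cbDeriv_eq hb hW hF, eq_empty_iff_forall_notMem]
  constructor
  · intro h
    by_contra hα
    obtain ⟨x, hx, -⟩ := exists_point (not_le.1 hα) ⊥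
    exact h x hx.ge
  · exact fun h x hx => ((lev_lt x).trans_le (h.trans hx)).false

theorem cbHeight_eq : cbHeight Omega2.{u} = ω_ 2 := by
  have : {α | cbDeriv Omega2.{u} α = ∅} = Ici (ω_ 2) :=
    Set.ext fun α => cbDeriv_eq_empty_iff hb hW hF
  rw [cbHeight, this, csInf_Ici]

theorem mk_cbLevel {α : Ordinal.{u}} (hα : α < ω_ 2) : #(cbLevel Omega2.{u} α) = ℵ_ 1 := by
  rw [cbLevel_eq hb hW hF]
  have e : {x : Omega2.{u} | lev x = α} ≃ Omega1.{u} := by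
    refine Equiv.ofBijective (fun x => col x.1) ⟨fun x y h => ?_, fun k => ?_⟩
    · exact Subtype.ext (eq_of_lev_col (x.2.trans y.2.symm) h)
    · obtain ⟨x, hx, hk⟩ := exists_point hα k
      exact ⟨⟨x, hx⟩, hk⟩
  have h := Cardinal.lift_mk_eq'.2 ⟨e⟩
  rw [mk_omega1] at h
  apply Cardinal.lift_injective.{u + 1}
  simpa using h

theorem cbWidth_eq : cbWidth Omega2.{u} = ℵ_ 1 := by
  rw [cbWidth, cbHeight_eq hb hW hF]
  have : Nonempty (Iio (ω_ 2 : Ordinal.{u})) := ⟨⟨0, Ordinal.omega_pos 2⟩⟩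
  rw [iSup_congr fun α : Iio (ω_ 2 : Ordinal.{u}) => mk_cbLevel hb hW hF α.2]
  exact ciSup_const

theorem isLLSPOf : IsLLSPOf Omega2.{u} (ℵ_ 1) (ω_ 2) where
  uncountable := Cardinal.aleph0_lt_aleph_one
  ne_zero := (Ordinal.omega_pos 2).ne'
  isLLSP :=
    { locallyLindelof := fun x => ⟨_, basic_mem_nhds hb x ⊥, isLindelof_basic hb hW x ⊥⟩
      scattered := ⟨ω_ 2, (cbDeriv_eq_empty_iff hb hW hF).2 le_rfl⟩
      t2 := t2Space hb hW
      pSpace := isPSpace hb }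
  height_eq := cbHeight_eq hb hW hF
  width_eq := cbWidth_eq hb hW hF

theorem isGood : IsGood Omega2.{u} := by
  intro α hα U hU hcount
  rw [cbHeight_eq hb hW hF] at hα
  choose x hx using hU
  have hsmall := isSmall_trace_of_isLindelof hb hW (isLindelof_iUnion fun n => (hx n).lindelof) α
  refine hsmall.not_countable_compl ((hcount.image col).mono fun k hk => ?_)
  obtain ⟨z, hz, rfl⟩ := exists_point hα k
  refine ⟨z, ⟨?_, fun hzU => hk ⟨z, ⟨hzU, hz⟩, rfl⟩⟩, rfl⟩
  rw [cbLevel_eq hb hW hF]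
  exact hz

theorem isLCCone_basic (x : Omega2.{u}) (η : Omega1.{u}) : IsLCCone (basic W x η) x where
  lindelof := isLindelof_basic hb hW x η
  clopen := isClopen_basic hb hW x η
  cone := by
    refine ⟨basic_mem_nhds hb x η, lev x, ?_, fun y hy β hβ hyβ => ?_⟩
    · rw [cbLevel_eq hb hW hF]
      rfl
    · rw [cbLevel_eq hb hW hF] at hyβ
      refine (eq_or_lev_lt_of_mem_basic hW hy).resolve_right fun h => ?_
      exact h.not_ge (hβ.trans_eq hyβ.symm)

theorem isAdmissible : IsAdmissible Omega2.{u} := by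
  have hbasis : ∀ x : Omega2.{u},
      (𝓝 x).HasBasis (fun V => V ∈ range (basic W x)) (fun V => V) := fun x =>
    (hb x).to_hasBasis (fun η _ => ⟨_, ⟨η, rfl⟩, Subset.rfl⟩) (by
      rintro _ ⟨η, rfl⟩
      exact ⟨η, trivial, Subset.rfl⟩)
  refine ⟨fun x => range (basic W x), hbasis, fun β _ => ⟨fun x hx => ⟨W x, hx, hbasis x, ?_, ?_,
    rfl⟩, fun x hx y hy hne U U' hU hU' ν μ => ?_⟩⟩
  · exact fun ν μ h => (hW _).disjoint x x rfl rfl ν μ fun h' => h (congrArg Prod.snd h')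
  · intro ν
    rw [cbLevel_eq hb hW hF] at hx
    obtain ⟨y, ζ, hy, hxν⟩ := (hF _).exists_of_eq_add_one x hx β rfl ν
    refine ⟨y, ?_, ?_⟩
    · rw [cbLevel_eq hb hW hF]
      exact hy
    · rw [hxν]
      exact isLCCone_basic hb hW hF y ζ
  · -- Whatever families give the two bases, their members lie in basic neighbourhoods.
    have hsub : ∀ {z : Omega2.{u}} {V : Omega1.{u} → Set Omega2.{u}},
        IsAdmissibleBasis β z (range (basic W z)) V → ∀ ν, V ν ⊆ basic W z ⊥ := by
      intro z V hV ν
      obtain ⟨η, hη⟩ := hV.eq_range.superset (mem_range_self ν)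
      refine Subset.trans (fun w hw => ?_) (basic_anti z (bot_le : ⊥ ≤ η))
      rw [hη]
      exact Or.inr (mem_iUnion₂.2 ⟨ν, le_rfl, hw⟩)
    rw [cbLevel_eq hb hW hF] at hx hy
    exact (disjoint_basic_of_lev_eq hW hne (hx.trans hy.symm) ⊥ ⊥).mono (hsub hU ν) (hsub hU' μ)

end Levels

theorem column_eq (k : Omega1.{u}) : column.{u} k.1 = {x | col x = k} := by
  ext x
  constructor
  · rintro ⟨μ, -, hx⟩
    refine Subtype.ext ?_
    change val x % _ = _
    rw [hx, Ordinal.mul_add_mod_self, Ordinal.mod_eq_of_lt k.2]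
  · rintro rfl
    exact ⟨lev x, lev_lt x, val_eq x⟩

end LLSP

theorem theorem2p1 :
    ∃ _ : TopologicalSpace LLSP.Omega2.{u},
      LLSP.IsLLSPOf LLSP.Omega2.{u} (ℵ_ 1) (ω_ 2) ∧
      LLSP.IsGood LLSP.Omega2.{u} ∧
      LLSP.IsAdmissible LLSP.Omega2.{u} ∧
      (∀ α < (ω_ 2 : Ordinal.{u}),
        LLSP.cbLevel LLSP.Omega2.{u} α =
          {x | ω_ 1 * α ≤ LLSP.val x ∧ LLSP.val x < ω_ 1 * (α + 1)}) ∧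
      (∀ ξ < (ω_ 1 : Ordinal.{u}),
        IsClosed (LLSP.column.{u} ξ) ∧ IsDiscrete (LLSP.column.{u} ξ)) ∧
      (∀ α < (ω_ 2 : Ordinal.{u}), α ≠ 0 →
        ¬ IsLindelof {x : LLSP.Omega2.{u} | LLSP.val x < ω_ 1 * α}) := by
  obtain ⟨W, hW, hF⟩ := LLSP.exists_neighbourhood_system.{u}
  obtain ⟨t, hb⟩ := LLSP.exists_topology hW
  refine ⟨t, LLSP.isLLSPOf hb hW hF, LLSP.isGood hb hW hF, LLSP.isAdmissible hb hW hF,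
    fun α _ => ?_, fun ξ hξ => ?_, fun α _ h0 => ?_⟩
  · rw [LLSP.cbLevel_eq hb hW hF]
    ext x
    simp only [mem_ofPred_eq, ← not_lt (a := LLSP.val x), LLSP.val_lt_mul_iff, not_lt,
      Order.lt_add_one_iff]
    exact ⟨fun h => ⟨h.ge, h.le⟩, fun h => le_antisymm h.2 h.1⟩
  · rw [LLSP.column_eq ⟨ξ, hξ⟩]
    exact LLSP.isClosed_column hb hW ⟨ξ, hξ⟩
  · simp only [LLSP.val_lt_mul_iff]
    exact LLSP.not_isLindelof_lev_lt hb hW h0
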